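/- Fix $d\ge 0$. A (rational) \emph{polyhedron} in $\mathbb{R}^d$ is a set $\{x\in\mathbb{R}^d : Ax\ge b\}$ with $A$ an integral matrix and $b$ an integral vector; a \emph{half-open polyhedron} is a set defined in the same way, where any of the finitely many inequalities may be strict. A \emph{polytope} (\emph{half-open polytope}) is a bounded polyhedron (bounded half-open polyhedron), and a \emph{partial polytopal complex} is a subset of $\mathbb{R}^d$ that is a disjoint union of finitely many half-open polytopes. For $X\subset\mathbb{R}^d$ and an integer $k\ge 1$ let $\operatorname{ehr}_X(k)=\#(\mathbb{Z}^d\cap kX)$. A function $q:\mathbb{Z}\to\mathbb{Q}$ is a \emph{quasipolynomial with period} $\ell\ge 1$ if there are polynomials $p_0,\dots,p_{\ell-1}\in\mathbb{Q}[t]$ such that $q(k)=p_r(k)$ whenever $k\in\mathbb{Z}$, $0\le r<\ell$ and $k\equiv r \pmod \ell$; it is a \emph{quasipolynomial} if it is one with some period. \textbf{Theorem (Ehrhart).} (1) If $X\subset\mathbb{R}^d$ is a partial polytopal complex, then $\mathbb{Z}^d\cap kX$ is finite for every integer $k\ge1$, and there is a quasipolynomial $q$ with $\operatorname{ehr}_X(k)=q(k)$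 for all integers $k\ge 1$. (2) If $P\subset\mathbb{R}^d$ is a polytope, then $P$ has finitely many vertices (extreme points) $v_1,\dots,v_N$, all of them in $\mathbb{Q}^d$. If $\ell$ is the least common multiple of the denominators (in lowest terms) of all coordinates $v_{i,j}$, $1\le i\le N$, $1\le j\le d$ (with $\ell=1$ if there are none), then there is a quasipolynomial $q$ with period $\ell$ such that $\operatorname{ehr}_P(k)=q(k)$ for all integers $k\ge 1$. -/

import Mathlib

open scoped Pointwise

namespace EhrhartTheory

/-- `P = {x ∈ ℝ^d | A x ≥ b}` for an integral matrix `A` and an integral vector `b`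
(all polyhedra are rational). -/
def IsPolyhedron {d : ℕ} (P : Set (Fin d → ℝ)) : Prop :=
  ∃ (m : ℕ) (A : Matrix (Fin m) (Fin d) ℤ) (b : Fin m → ℤ),
    P = {x | ∀ i, (b i : ℝ) ≤ ∑ j, (A i j : ℝ) * x j}

/-- A polytope is a bounded polyhedron. -/
def IsPolytope {d : ℕ} (P : Set (Fin d → ℝ)) : Prop :=
  IsPolyhedron P ∧ Bornology.IsBounded P

/-- A half-open polyhedron: finitely many weak or strict inequalities with integral data.
The set `S` says which inequalities are strict; `S = ∅` is allowed. -/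
def IsHalfOpenPolyhedron {d : ℕ} (P : Set (Fin d → ℝ)) : Prop :=
  ∃ (m : ℕ) (A : Matrix (Fin m) (Fin d) ℤ) (b : Fin m → ℤ) (S : Set (Fin m)),
    P = {x | (∀ i ∉ S, (b i : ℝ) ≤ ∑ j, (A i j : ℝ) * x j) ∧
             (∀ i ∈ S, (b i : ℝ) < ∑ j, (A i j : ℝ) * x j)}

/-- A half-open polytope is a bounded half-open polyhedron. -/
def IsHalfOpenPolytope {d : ℕ} (P : Set (Fin d → ℝ)) : Prop :=
  IsHalfOpenPolyhedron P ∧ Bornology.IsBounded P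

/-- A partial polytopal complex is a set that is a (finite) disjoint union of half-open
polytopes. -/
def IsPartialPolytopalComplex {d : ℕ} (X : Set (Fin d → ℝ)) : Prop :=
  ∃ (n : ℕ) (Q : Fin n → Set (Fin d → ℝ)),
    (∀ i, IsHalfOpenPolytope (Q i)) ∧ Pairwise (fun i j => Disjoint (Q i) (Q j)) ∧
      X = ⋃ i, Q i

/-- The integer points `ℤ^d ∩ k X`. -/
def latticePoints {d : ℕ} (X : Set (Fin d → ℝ)) (k : ℕ) : Set (Fin d → ℤ) :=
  {z | (fun j => (z j : ℝ)) ∈ (k : ℝ) • X}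

/-- The Ehrhart function `k ↦ #(ℤ^d ∩ k X)`; it is only used for `k ≥ 1`. -/
noncomputable def ehr {d : ℕ} (X : Set (Fin d → ℝ)) (k : ℕ) : ℕ :=
  (latticePoints X k).ncard

/-- `q : ℤ → ℚ` is a quasipolynomial with constituents `c 0, …, c (ℓ - 1)` for some `c`,
that is, a quasipolynomial having `ℓ ≥ 1` as a period. -/
def IsQuasipolynomialWithPeriod (q : ℤ → ℚ) (ℓ : ℕ) : Prop :=
  1 ≤ ℓ ∧ ∃ c : Fin ℓ → Polynomial ℚ,
    ∀ (k : ℤ) (r : Fin ℓ), k ≡ (r : ℕ) [ZMOD ℓ] → q k = (c r).eval (k : ℚ)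

/-- A quasipolynomial, of some period. -/
def IsQuasipolynomial (q : ℤ → ℚ) : Prop :=
  ∃ ℓ : ℕ, IsQuasipolynomialWithPeriod q ℓ

/-- `f`, regarded as defined at the positive integers only, is given by `q`. -/
def AgreesOnPositive (f : ℕ → ℕ) (q : ℤ → ℚ) : Prop :=
  ∀ k : ℕ, 1 ≤ k → (f k : ℚ) = q k

/-- The least common multiple of the (reduced) denominators of all coordinates of the
points of `V`. -/
def lcmDenominators {d : ℕ} (V : Finset (Fin d → ℚ)) : ℕ :=
  V.lcm fun v => Finset.univ.lcm fun j => (v j).den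

end EhrhartTheory

/-!
Let `v₁, …, v_N` be the vertices of a polytope `P` and let `ℓ` clear their denominators. Among the
nonnegative coefficient vectors `c` with given mass `∑ cᵢ` and given point `∑ cᵢ vᵢ` there is
exactly one lexicographically smallest, and whether `c` is the smallest depends only on its support:
these supports are the simplices of a triangulation of `P` without new vertices. Whether a convex
combination of the vertices satisfies a strict form of one of the inequalities of `P` depends only
on the support as well. Hence, for a half-open polytope `Q` obtained from `P`, the points of
`ℤ^d ∩ kQ` correspond to the vectors of mass `k` in a set of coefficient vectors that is stable
under adding natural multiples of `ℓ` to nonzero coordinates. Each such vector is uniquely a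
remainder with coordinates in `(0, ℓ]` on its support `W`, one of finitely many, plus `ℓ` times an
element of `ℕ^W`, and the number of elements of `ℕ^W` with given sum is a binomial coefficient,
hence polynomial. As the remainder has mass at most `ℓ · #W`, the polynomial counts correctly from
`k = 1` on.
-/

namespace EhrhartTheory

open Function Polynomial Topology

section QuasiPeriod

/-- On the positive integers, `f` agrees with a quasipolynomial that has `ℓ` as a period. -/
def HasQuasiPeriod (f : ℕ → ℕ) (ℓ : ℕ) : Prop :=
  ∃ q : ℤ → ℚ, IsQuasipolynomialWithPeriod q ℓ ∧ AgreesOnPositive f q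

variable {f g : ℕ → ℕ} {ℓ : ℕ}

lemma HasQuasiPeriod.congr (hf : HasQuasiPeriod f ℓ) (h : ∀ k, 1 ≤ k → g k = f k) :
    HasQuasiPeriod g ℓ := by
  obtain ⟨q, hq, hfq⟩ := hf
  exact ⟨q, hq, fun k hk => by rw [h k hk, hfq k hk]⟩

lemma HasQuasiPeriod.of_dvd {L : ℕ} (hf : HasQuasiPeriod f ℓ) (hL : 1 ≤ L) (h : ℓ ∣ L) :
    HasQuasiPeriod f L := by
  obtain ⟨q, ⟨hℓ, c, hc⟩, hfq⟩ := hf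
  refine ⟨q, ⟨hL, fun r => c ⟨r % ℓ, Nat.mod_lt _ hℓ⟩, fun k r hr => hc k _ ?_⟩, hfq⟩
  exact (hr.of_dvd (Int.natCast_dvd_natCast.mpr h)).trans (by simp [Int.ModEq])

lemma HasQuasiPeriod.sum {ι : Type*} (hℓ : 1 ≤ ℓ) (s : Finset ι) {F : ι → ℕ → ℕ}
    (hF : ∀ i ∈ s, HasQuasiPeriod (F i) ℓ) : HasQuasiPeriod (fun k => ∑ i ∈ s, F i k) ℓ := by
  choose! q hq hFq using hF
  choose! c hc using fun i hi => (hq i hi).2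
  refine ⟨fun k => ∑ i ∈ s, q i k, ⟨hℓ, fun r => ∑ i ∈ s, c i r, fun k r hr => ?_⟩,
    fun k hk => ?_⟩
  · rw [eval_finsetSum]
    exact Finset.sum_congr rfl fun i hi => hc i hi k r hr
  · push_cast
    exact Finset.sum_congr rfl fun i hi => hFq i hi k hk

lemma HasQuasiPeriod.zero (hℓ : 1 ≤ ℓ) : HasQuasiPeriod (fun _ => 0) ℓ := by
  simpa using HasQuasiPeriod.sum hℓ ∅ (F := fun (_ : ℕ) _ => 0) (by simp)

lemma HasQuasiPeriod.of_eval_eq (hℓ : 1 ≤ ℓ) (p : ℕ → ℚ[X])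
    (h : ∀ r < ℓ, ∀ m : ℕ, (f (ℓ * m + r + 1) : ℚ) = (p r).eval (m : ℚ)) :
    HasQuasiPeriod f ℓ := by
  let c (r : ℕ) : ℚ[X] := (p r).comp (C (ℓ : ℚ)⁻¹ * (X - C ((r : ℚ) + 1)))
  refine ⟨fun k => (c ((k - 1) % ℓ).toNat).eval (k : ℚ),
    ⟨hℓ, fun r => c (((r : ℤ) - 1) % ℓ).toNat, fun k r hr => ?_⟩, fun k hk => ?_⟩
  · have hkr : (k - 1) % (ℓ : ℤ) = (r - 1) % ℓ := hr.sub_right 1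
    simp only [hkr]
  · obtain ⟨k, rfl⟩ := Nat.exists_eq_add_of_le' hk
    have hmod : ((k + 1 : ℕ) - 1 : ℤ) % ℓ = (k % ℓ : ℕ) := by simp
    have hdiv : (ℓ : ℚ) * (k / ℓ : ℕ) + (k % ℓ : ℕ) = k := by exact_mod_cast Nat.div_add_mod k ℓ
    have hk := h (k % ℓ) (Nat.mod_lt k hℓ) (k / ℓ)
    rw [Nat.div_add_mod] at hk
    simp only [hk, hmod, Int.toNat_natCast, c, eval_comp, eval_mul, eval_C, eval_sub, eval_X]
    congr 1
    field_simp
    push_cast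
    linarith

end QuasiPeriod

section Counting

variable {ι : Type*} {ℓ : ℕ}

lemma card_piAntidiag [DecidableEq ι] (W : Finset ι) (t : ℕ) :
    (W.piAntidiag t).card = (W.card + t - 1).choose t := by
  rw [← Finset.card_finsuppAntidiag_nat_eq_choose, Finset.finsuppAntidiag, Finset.card_map,
    Finset.card_attach]

-- The binomial coefficient also gives the correct count `0` when `m < u`.
lemma ncard_setOf_add_sum_eq {W : Finset ι} {u : ℕ} (hu : u < W.card) (m : ℕ) :
    {n : ι → ℕ | u + ∑ i ∈ W, n i = m ∧ ∀ i, n i ≠ 0 → i ∈ W}.ncard =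
      (m + (W.card - 1 - u)).choose (W.card - 1) := by
  classical
  rcases lt_or_ge m u with hm | hm
  · have hempty : {n : ι → ℕ | u + ∑ i ∈ W, n i = m ∧ ∀ i, n i ≠ 0 → i ∈ W} = ∅ :=
      Set.eq_empty_of_forall_notMem fun n hn => by have := hn.1; omega
    rw [hempty, Set.ncard_empty, Nat.choose_eq_zero_of_lt (by omega)]
  · obtain ⟨t, rfl⟩ := Nat.exists_eq_add_of_le hm
    have hset : {n : ι → ℕ | u + ∑ i ∈ W, n i = u + t ∧ ∀ i, n i ≠ 0 → i ∈ W} =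
        W.piAntidiag t := by
      ext n
      simp
    rw [hset, Set.ncard_coe_finset, card_piAntidiag, ← Nat.choose_symm (by omega)]
    congr 1 <;> omega

/-- Where there is nothing to count, for `1 ≤ k < s`, the counting polynomial vanishes because of
`s ≤ ℓ * W.card`. -/
lemma hasQuasiPeriod_ncard_setOf_add_mul_sum_eq {W : Finset ι} {s : ℕ} (hℓ : 1 ≤ ℓ) (hs : 1 ≤ s)
    (hsW : s ≤ ℓ * W.card) :
    HasQuasiPeriod
      (fun k => {n : ι → ℕ | s + ℓ * ∑ i ∈ W, n i = k ∧ ∀ i, n i ≠ 0 → i ∈ W}.ncard) ℓ := by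
  obtain ⟨s, rfl⟩ := Nat.exists_eq_add_of_le' hs
  have hu : s / ℓ < W.card := Nat.div_lt_of_lt_mul hsW
  have hmass (t m r : ℕ) (hr : r < ℓ) :
      s + 1 + ℓ * t = ℓ * m + r + 1 ↔ r = s % ℓ ∧ s / ℓ + t = m := by
    rw [show s + 1 + ℓ * t = ℓ * m + r + 1 ↔ s + ℓ * t = r + ℓ * m by omega]
    refine ⟨fun h => ?_, ?_⟩
    · have hmod := congrArg (· % ℓ) h
      have hdiv := congrArg (· / ℓ) h
      simp only [Nat.add_mul_mod_self_left, Nat.mod_eq_of_lt hr] at hmod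
      simp only [Nat.add_mul_div_left _ _ hℓ, Nat.div_eq_of_lt hr, zero_add] at hdiv
      exact ⟨hmod.symm, hdiv⟩
    · rintro ⟨rfl, rfl⟩
      linarith [Nat.div_add_mod s ℓ]
  refine HasQuasiPeriod.of_eval_eq hℓ (fun r => if r = s % ℓ then
    C ((W.card - 1).factorial : ℚ)⁻¹ *
      (descPochhammer ℚ (W.card - 1)).comp (X + C ((W.card - 1 - s / ℓ : ℕ) : ℚ)) else 0)
    fun r hr m => ?_
  simp only [hmass _ _ _ hr]
  split_ifs with h
  · simp only [h, true_and, ncard_setOf_add_sum_eq hu, Nat.cast_choose_eq_descPochhammer_div ℚ]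
    simp [div_eq_inv_mul]
  · simp [h]

end Counting

section Box

variable {ι : Type*} {ℓ : ℕ}

/-- The quotient of `a` on division by `ℓ`, where the remainder of a positive number is taken in
`(0, ℓ]`; at `a = 0` the truncated subtraction gives quotient and remainder `0`. -/
noncomputable def boxQuot (ℓ : ℕ) (a : ℝ) : ℕ := ⌈a / ℓ⌉₊ - 1

/-- The coordinatewise remainder that goes with `boxQuot`: it has the same support as `c` and, if
`c` is nonnegative, it lies in the box `[0, ℓ] ^ ι`. -/
noncomputable def boxPart (ℓ : ℕ) (c : ι → ℝ) : ι → ℝ := fun i => c i - ℓ * boxQuot ℓ (c i)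

lemma boxQuot_zero : boxQuot ℓ 0 = 0 := by simp [boxQuot]

lemma boxQuot_add_mul (hℓ : 1 ≤ ℓ) {a : ℝ} (ha₀ : 0 < a) (ha : a ≤ ℓ) (n : ℕ) :
    boxQuot ℓ (a + ℓ * n) = n := by
  have hℓ₀ : (0 : ℝ) < ℓ := by exact_mod_cast hℓ
  have hceil : ⌈a / ℓ⌉₊ = 1 := by
    rw [Nat.ceil_eq_iff one_ne_zero]
    exact ⟨by simpa using div_pos ha₀ hℓ₀, by simpa using (div_le_one hℓ₀).mpr ha⟩
  rw [boxQuot, add_div, mul_div_cancel_left₀ _ hℓ₀.ne', Nat.ceil_add_natCast (by positivity), hceil]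
  omega

lemma sub_mul_boxQuot_mem_Ioc (hℓ : 1 ≤ ℓ) {a : ℝ} (ha : 0 < a) :
    a - ℓ * boxQuot ℓ a ∈ Set.Ioc (0 : ℝ) ℓ := by
  have hℓ₀ : (0 : ℝ) < ℓ := by exact_mod_cast hℓ
  obtain ⟨n, hn⟩ := Nat.exists_eq_add_of_le' (Nat.ceil_pos.mpr (div_pos ha hℓ₀))
  obtain ⟨hlt, hle⟩ := (Nat.ceil_eq_iff (by omega)).mp hn
  rw [lt_div_iff₀ hℓ₀] at hlt
  rw [div_le_iff₀ hℓ₀] at hle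
  rw [boxQuot, hn]
  push_cast [Nat.add_sub_cancel] at hlt hle ⊢
  exact ⟨by linarith, by linarith⟩

lemma boxPart_add_mul (hℓ : 1 ≤ ℓ) {f : ι → ℝ} {n : ι → ℕ} (hf₀ : 0 ≤ f) (hf : ∀ i, f i ≤ ℓ)
    (hn : ∀ i, n i ≠ 0 → f i ≠ 0) : boxPart ℓ (fun i => f i + ℓ * n i) = f := by
  funext i
  rcases (hf₀ i).eq_or_lt' with hi | hi
  · have : n i = 0 := of_not_not fun h => hn i h hi
    simp [boxPart, hi, this, boxQuot_zero]
  · simp [boxPart, boxQuot_add_mul hℓ hi (hf i)]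

lemma boxPart_add_mul_boxQuot (c : ι → ℝ) :
    (fun i => boxPart ℓ c i + ℓ * boxQuot ℓ (c i)) = c := by
  simp [boxPart]

lemma boxPart_mem_Icc (hℓ : 1 ≤ ℓ) {c : ι → ℝ} (hc : 0 ≤ c) (i : ι) :
    boxPart ℓ c i ∈ Set.Icc (0 : ℝ) ℓ := by
  rcases (hc i).eq_or_lt' with hi | hi
  · simp [boxPart, hi, boxQuot_zero]
  · exact Set.Ioc_subset_Icc_self (sub_mul_boxQuot_mem_Ioc hℓ hi)

lemma boxPart_eq_zero_iff (hℓ : 1 ≤ ℓ) {c : ι → ℝ} (hc : 0 ≤ c) {i : ι} :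
    boxPart ℓ c i = 0 ↔ c i = 0 := by
  refine ⟨fun h => of_not_not fun hi => ?_, fun h => by simp [boxPart, h, boxQuot_zero]⟩
  exact (sub_mul_boxQuot_mem_Ioc hℓ ((hc i).lt_of_ne' hi)).1.ne' h

lemma boxPart_ne_zero_of_boxQuot_ne_zero (hℓ : 1 ≤ ℓ) {c : ι → ℝ} (hc : 0 ≤ c) {i : ι}
    (hi : boxQuot ℓ (c i) ≠ 0) : boxPart ℓ c i ≠ 0 := fun h =>
  hi (by rw [(boxPart_eq_zero_iff hℓ hc).mp h, boxQuot_zero])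

/-- Sets of nonnegative vectors that are stable under moving by `ℓ` in the directions of the
support of a vector, forwards and backwards as long as the support does not change. -/
structure IsSupportPeriodic (ℓ : ℕ) (L : Set (ι → ℝ)) : Prop where
  nonneg : ∀ c ∈ L, 0 ≤ c
  add_mul_mem_iff : ∀ (c : ι → ℝ) (n : ι → ℕ), 0 ≤ c → (∀ i, n i ≠ 0 → c i ≠ 0) →
    ((fun i => c i + ℓ * n i) ∈ L ↔ c ∈ L)

variable {L : Set (ι → ℝ)}

lemma IsSupportPeriodic.boxPart_mem (hL : IsSupportPeriodic ℓ L) (hℓ : 1 ≤ ℓ) {c : ι → ℝ}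
    (hc : c ∈ L) : boxPart ℓ c ∈ L := by
  have hc₀ := hL.nonneg c hc
  rw [← hL.add_mul_mem_iff _ _ (fun i => (boxPart_mem_Icc hℓ hc₀ i).1)
    fun i => boxPart_ne_zero_of_boxQuot_ne_zero hℓ hc₀, boxPart_add_mul_boxQuot]
  exact hc

variable [Fintype ι]

/-- The elements of `L` of total mass `k`. -/
def massSlice (L : Set (ι → ℝ)) (k : ℕ) : Set (ι → ℝ) := {c ∈ L | ∑ i, c i = k}

/-- The possible remainders modulo `ℓ` of the elements of `L` of positive integral mass. -/
def boxPoints (ℓ : ℕ) (L : Set (ι → ℝ)) : Set (ι → ℝ) :=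
  {f | (∀ i, f i ≤ ℓ) ∧ ∃ s ≥ 1, f ∈ massSlice L s}

lemma finite_boxPoints (hfin : ∀ k ≥ 1, (massSlice L k).Finite) : (boxPoints ℓ L).Finite := by
  refine ((Set.finite_Icc 1 (ℓ * Fintype.card ι)).biUnion fun s hs => hfin s hs.1).subset ?_
  rintro f ⟨hf, s, hs, hfs⟩
  refine Set.mem_biUnion ⟨hs, ?_⟩ hfs
  have hle : ∑ i, f i ≤ ∑ _i : ι, (ℓ : ℝ) := Finset.sum_le_sum fun i _ => hf i
  rw [hfs.2, Finset.sum_const, Finset.card_univ, nsmul_eq_mul, mul_comm] at hle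
  exact_mod_cast hle

lemma sum_add_mul (f : ι → ℝ) (n : ι → ℕ) :
    ∑ i, (f i + ℓ * n i) = ∑ i, f i + (ℓ * ∑ i, n i : ℕ) := by
  simp [Finset.sum_add_distrib, Finset.mul_sum]

lemma IsSupportPeriodic.boxPart_mem_boxPoints (hL : IsSupportPeriodic ℓ L) (hℓ : 1 ≤ ℓ) {k : ℕ}
    (hk : 1 ≤ k) {c : ι → ℝ} (hc : c ∈ massSlice L k) : boxPart ℓ c ∈ boxPoints ℓ L := by
  have hc₀ := hL.nonneg c hc.1
  have hbox := boxPart_mem_Icc hℓ hc₀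
  have hsum : ∑ i, boxPart ℓ c i + (ℓ * ∑ i, boxQuot ℓ (c i) : ℕ) = k := by
    rw [← sum_add_mul, boxPart_add_mul_boxQuot, hc.2]
  have hpos : 0 < ∑ i, boxPart ℓ c i := by
    have hmass : ∑ i, c i ≠ 0 := by rw [hc.2]; positivity
    obtain ⟨i, hi, hci⟩ := Finset.exists_ne_zero_of_sum_ne_zero hmass
    refine Finset.sum_pos' (fun i _ => (hbox i).1) ⟨i, hi, (hbox i).1.lt_of_ne' ?_⟩
    rwa [Ne, boxPart_eq_zero_iff hℓ hc₀]
  have hlt : ℓ * ∑ i, boxQuot ℓ (c i) < k := by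
    exact_mod_cast (by linarith : ((ℓ * ∑ i, boxQuot ℓ (c i) : ℕ) : ℝ) < k)
  refine ⟨fun i => (hbox i).2, k - ℓ * ∑ i, boxQuot ℓ (c i), Nat.sub_pos_of_lt hlt,
    hL.boxPart_mem hℓ hc.1, ?_⟩
  rw [Nat.cast_sub hlt.le]
  linarith

lemma IsSupportPeriodic.setOf_boxPart_eq (hL : IsSupportPeriodic ℓ L) (hℓ : 1 ≤ ℓ) {f : ι → ℝ}
    (hf : ∀ i, f i ≤ ℓ) {s : ℕ} (hfs : f ∈ massSlice L s) (k : ℕ) :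
    {c ∈ massSlice L k | boxPart ℓ c = f} = (fun (n : ι → ℕ) i => f i + ℓ * n i) ''
      {n | s + ℓ * ∑ i, n i = k ∧ ∀ i, n i ≠ 0 → f i ≠ 0} := by
  have hf₀ := hL.nonneg f hfs.1
  ext c
  constructor
  · rintro ⟨⟨hcL, hck⟩, rfl⟩
    refine ⟨fun i => boxQuot ℓ (c i), ⟨?_, fun i => boxPart_ne_zero_of_boxQuot_ne_zero hℓ
      (hL.nonneg c hcL)⟩, boxPart_add_mul_boxQuot c⟩
    have hsum := sum_add_mul (ℓ := ℓ) (boxPart ℓ c) fun i => boxQuot ℓ (c i)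
    rw [boxPart_add_mul_boxQuot, hck, hfs.2] at hsum
    exact_mod_cast hsum.symm
  · rintro ⟨n, ⟨hnk, hn⟩, rfl⟩
    refine ⟨⟨(hL.add_mul_mem_iff f n hf₀ hn).mpr hfs.1, ?_⟩, boxPart_add_mul hℓ hf₀ hf hn⟩
    rw [sum_add_mul, hfs.2, ← hnk]
    push_cast
    rfl

lemma IsSupportPeriodic.hasQuasiPeriod_ncard_setOf_boxPart_eq (hL : IsSupportPeriodic ℓ L)
    (hℓ : 1 ≤ ℓ) {f : ι → ℝ} (hf : f ∈ boxPoints ℓ L) :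
    HasQuasiPeriod (fun k => {c ∈ massSlice L k | boxPart ℓ c = f}.ncard) ℓ := by
  classical
  obtain ⟨hfℓ, s, hs, hfs⟩ := hf
  let W := Finset.univ.filter fun i => f i ≠ 0
  have hW (i : ι) : i ∈ W ↔ f i ≠ 0 := by simp [W]
  have hsW : s ≤ ℓ * W.card := by
    have hle : ∑ i ∈ W, f i ≤ W.card • (ℓ : ℝ) := Finset.sum_le_card_nsmul _ _ _ fun i _ => hfℓ i
    rw [Finset.sum_filter_ne_zero, hfs.2, nsmul_eq_mul, mul_comm] at hle
    exact_mod_cast hle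
  refine (hasQuasiPeriod_ncard_setOf_add_mul_sum_eq (ι := ι) hℓ hs hsW).congr fun k _ => ?_
  have hinj : Injective fun (n : ι → ℕ) i => f i + ℓ * n i := fun n n' h => funext fun i => by
    simpa [Nat.ne_zero_of_lt hℓ] using congrFun h i
  rw [hL.setOf_boxPart_eq hℓ hfℓ hfs, Set.ncard_image_of_injective _ hinj]
  congr 1
  ext n
  simp only [Set.mem_ofPred_eq, hW]
  refine and_congr_left fun hn => ?_
  rw [Finset.sum_filter_of_ne fun i _ => hn i]

theorem IsSupportPeriodic.hasQuasiPeriod_ncard_massSlice (hL : IsSupportPeriodic ℓ L)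
    (hℓ : 1 ≤ ℓ) (hfin : ∀ k ≥ 1, (massSlice L k).Finite) :
    HasQuasiPeriod (fun k => (massSlice L k).ncard) ℓ := by
  classical
  let D := (finite_boxPoints (ℓ := ℓ) hfin).toFinset
  refine (HasQuasiPeriod.sum hℓ D fun f hf =>
    hL.hasQuasiPeriod_ncard_setOf_boxPart_eq hℓ (by simpa [D] using hf)).congr fun k hk => ?_
  have hmaps : ∀ c ∈ (hfin k hk).toFinset, boxPart ℓ c ∈ D := fun c hc => by
    simpa [D] using hL.boxPart_mem_boxPoints hℓ hk (by simpa using hc)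
  rw [Set.ncard_eq_toFinset_card _ (hfin k hk), Finset.card_eq_sum_card_fiberwise hmaps]
  refine Finset.sum_congr rfl fun f _ => ?_
  rw [← Set.ncard_coe_finset]
  simp

end Box

section LexMinimal

variable {ι : Type*}

lemma exists_pos_add_smul_nonneg [Finite ι] {c w : ι → ℝ} (hc : 0 ≤ c)
    (hw : ∀ i, c i = 0 → 0 ≤ w i) : ∃ ε > (0 : ℝ), 0 ≤ c + ε • w := by
  have hev : ∀ᶠ ε : ℝ in 𝓝[>] 0, ∀ i, 0 ≤ c i + ε * w i := by
    refine Filter.eventually_all.mpr fun i => ?_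
    rcases (hc i).eq_or_lt' with hi | hi
    · filter_upwards [self_mem_nhdsWithin] with ε hε
      have hi : c i = 0 := hi
      simpa [hi] using mul_nonneg (le_of_lt hε) (hw i hi)
    · have hcont : Filter.Tendsto (fun ε : ℝ => c i + ε * w i) (𝓝[>] 0) (𝓝 (c i)) :=
        tendsto_nhdsWithin_of_tendsto_nhds <| Continuous.tendsto' (by fun_prop) _ _ (by simp)
      exact (hcont.eventually (lt_mem_nhds hi)).mono fun ε => le_of_lt
  obtain ⟨ε, hε, hpos⟩ := (hev.and self_mem_nhdsWithin).exists
  exact ⟨ε, hpos, hε⟩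

lemma exists_forall_toLex_le {X α : Type*} [TopologicalSpace X] [LinearOrder α]
    [TopologicalSpace α] [OrderClosedTopology α] {n : ℕ} {K : Set X} (hK : IsCompact K)
    (hne : K.Nonempty) {f : X → Fin n → α} (hf : ∀ i, Continuous fun x => f x i) :
    ∃ x ∈ K, ∀ y ∈ K, toLex (f x) ≤ toLex (f y) := by
  induction n generalizing K with
  | zero =>
    obtain ⟨x, hx⟩ := hne
    exact ⟨x, hx, fun y _ => (congrArg toLex (Subsingleton.elim (f x) (f y))).le⟩
  | succ n ih =>
    obtain ⟨x₀, hx₀, hmin₀⟩ := hK.exists_isMinOn hne (hf 0).continuousOn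
    obtain ⟨x, ⟨hxK, hxx₀ : f x 0 = f x₀ 0⟩, hmin⟩ :=
      ih (K := K ∩ {x | f x 0 = f x₀ 0}) (hK.inter_right (isClosed_eq (hf 0) continuous_const))
        ⟨x₀, hx₀, rfl⟩ (f := fun x i => f x i.succ) fun i => hf i.succ
    refine ⟨x, hxK, fun y hy => not_lt.mp fun hyx => ?_⟩
    obtain ⟨j, heq, hlt⟩ : toLex (f y) < toLex (f x) := hyx
    induction j using Fin.cases with
    | zero => exact (isMinOn_iff.mp hmin₀ y hy).not_gt (hlt.trans_eq hxx₀)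
    | succ j =>
      have hyx : f y 0 = f x 0 := heq 0 j.succ_pos
      exact (hmin y ⟨hy, hyx.trans hxx₀⟩).not_gt
        ⟨j, fun i hi => heq i.succ (Fin.succ_lt_succ_iff.mpr hi), hlt⟩

variable [LinearOrder ι] {F : Type*} [AddCommGroup F] [Module ℝ F]

/-- `c` is the lexicographically smallest nonnegative vector in its fibre under `T`. If `T` maps
the unit vectors to generators of a cone, then the supports of these vectors are the faces of a
triangulation of the cone without new rays. -/
def IsLexMinimal (T : (ι → ℝ) →ₗ[ℝ] F) (c : ι → ℝ) : Prop :=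
  0 ≤ c ∧ ∀ c' : ι → ℝ, 0 ≤ c' → T c' = T c → toLex c ≤ toLex c'

variable {T : (ι → ℝ) →ₗ[ℝ] F} {c c' : ι → ℝ}

lemma IsLexMinimal.eq_of_map_eq (hc : IsLexMinimal T c) (hc' : IsLexMinimal T c')
    (h : T c = T c') : c = c' :=
  toLex_inj.mp <| (hc.2 c' hc'.1 h.symm).antisymm (hc'.2 c hc.1 h)

variable [Finite ι]

/-- If the vector with the smaller support could be decreased, a small step from `c` in the same
direction would keep the coordinates nonnegative and decrease `c`. -/
lemma IsLexMinimal.of_support_subset (hc : IsLexMinimal T c) (hc' : 0 ≤ c')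
    (h : support c' ⊆ support c) : IsLexMinimal T c' := by
  refine ⟨hc', fun c'' hc'' hT => not_lt.mp fun ⟨j, heq, hlt⟩ => ?_⟩
  obtain ⟨ε, hε, hnonneg⟩ := exists_pos_add_smul_nonneg (w := c'' - c') hc.1 fun i hi => by
    have : c' i = 0 := notMem_support.mp fun hi' => h hi' hi
    simpa [this] using hc'' i
  refine (hc.2 _ hnonneg (by simp [hT])).not_gt ⟨j, fun i hi => ?_, ?_⟩
  · have : c'' i = c' i := heq i hi
    simp [this]
  · have : c'' j < c' j := hlt
    simpa using mul_neg_of_pos_of_neg hε (sub_neg.mpr this)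

lemma isLexMinimal_iff_of_support_eq (hc : 0 ≤ c) (hc' : 0 ≤ c') (h : support c = support c') :
    IsLexMinimal T c ↔ IsLexMinimal T c' :=
  ⟨fun hmin => hmin.of_support_subset hc' h.ge, fun hmin => hmin.of_support_subset hc h.le⟩

end LexMinimal

section ConvexHull

variable {ι E : Type*} [Fintype ι] [AddCommGroup E] [Module ℝ E]

/-- The linear map that sends a coefficient vector to its total mass and to the linear combination
of the points `v i`. -/
noncomputable def massAndSum (v : ι → E) : (ι → ℝ) →ₗ[ℝ] ℝ × E :=
  Fintype.linearCombination ℝ fun i => (1, v i)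

lemma massAndSum_apply (v : ι → E) (c : ι → ℝ) :
    massAndSum v c = (∑ i, c i, ∑ i, c i • v i) := by
  simp [massAndSum, Fintype.linearCombination_apply, Prod.ext_iff, Prod.fst_sum, Prod.snd_sum]

lemma convexHull_range_eq_image_stdSimplex (v : ι → E) :
    convexHull ℝ (Set.range v) = (fun c : ι → ℝ => ∑ i, c i • v i) '' stdSimplex ℝ ι := by
  classical
  have hv : Set.range v = Fintype.linearCombination ℝ v ''
      Set.range fun i => (Pi.single i 1 : ι → ℝ) := by
    rw [← Set.range_comp]
    congr 1
    ext1 i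
    simp [Fintype.linearCombination_apply_single]
  rw [hv, ← LinearMap.image_convexHull, convexHull_rangle_single_eq_stdSimplex]
  rfl

lemma exists_isLexMinimal_sum_smul_eq [TopologicalSpace E] [ContinuousAdd E]
    [ContinuousSMul ℝ E] [T2Space E] {n : ℕ} (v : Fin n → E) {x : E}
    (hx : x ∈ convexHull ℝ (Set.range v)) :
    ∃ c ∈ stdSimplex ℝ (Fin n), ∑ i, c i • v i = x ∧ IsLexMinimal (massAndSum v) c := by
  rw [convexHull_range_eq_image_stdSimplex] at hx
  have hcomp : IsCompact (stdSimplex ℝ (Fin n) ∩ {c | ∑ i, c i • v i = x}) :=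
    (isCompact_stdSimplex ℝ (Fin n)).inter_right (isClosed_eq (by fun_prop) continuous_const)
  obtain ⟨c, ⟨hc, hcx⟩, hmin⟩ := exists_forall_toLex_le hcomp hx (f := id) continuous_apply
  refine ⟨c, hc, hcx, hc.1, fun c' hc' hcc' => hmin c' ?_⟩
  simp only [massAndSum_apply, Prod.mk.injEq] at hcc'
  exact ⟨⟨hc', hcc'.1.trans hc.2⟩, hcc'.2.trans hcx⟩

end ConvexHull

section LatticePoints

variable {d : ℕ} {X : Set (Fin d → ℝ)} {k : ℕ}

/-- The lattice `ℤ^d` in `ℝ^d`. -/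
def integerLattice (d : ℕ) : AddSubgroup (Fin d → ℝ) :=
  ((Int.castAddHom ℝ).compLeft (Fin d)).range

lemma injective_intCast_comp : Injective fun (z : Fin d → ℤ) (j : Fin d) => (z j : ℝ) :=
  Int.cast_injective.comp_left

lemma image_latticePoints :
    (fun (z : Fin d → ℤ) (j : Fin d) => (z j : ℝ)) '' latticePoints X k =
      ((k : ℝ) • X) ∩ integerLattice d :=
  Set.image_preimage_eq_inter_range

lemma ehr_eq_ncard_smul_inter_integerLattice :
    ehr X k = (((k : ℝ) • X) ∩ integerLattice d).ncard := by
  rw [← image_latticePoints, Set.ncard_image_of_injective _ injective_intCast_comp, ehr]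

lemma finite_latticePoints (hX : Bornology.IsBounded X) (k : ℕ) : (latticePoints X k).Finite := by
  obtain ⟨R, hR⟩ := (hX.smul₀ (k : ℝ)).exists_norm_le
  obtain ⟨B, hB⟩ := exists_nat_ge R
  refine (Set.finite_Icc (fun _ : Fin d => -(B : ℤ)) fun _ => B).subset fun z hz => ?_
  have habs (j : Fin d) : |(z j : ℝ)| ≤ B :=
    (norm_le_pi_norm (fun j => (z j : ℝ)) j).trans ((hR _ hz).trans hB)
  exact ⟨fun j => by exact_mod_cast (abs_le.mp (habs j)).1,
    fun j => by exact_mod_cast (abs_le.mp (habs j)).2⟩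

lemma ehr_iUnion {ι : Type*} [Fintype ι] {Q : ι → Set (Fin d → ℝ)}
    (hQ : ∀ i, Bornology.IsBounded (Q i)) (hdisj : Pairwise fun i j => Disjoint (Q i) (Q j))
    (hk : 1 ≤ k) : ehr (⋃ i, Q i) k = ∑ i, ehr (Q i) k := by
  have hk₀ : (k : ℝ) ≠ 0 := by positivity
  have hUnion : latticePoints (⋃ i, Q i) k = ⋃ i, latticePoints (Q i) k := by
    ext z
    simp [latticePoints, Set.smul_set_iUnion]
  rw [ehr, hUnion, Set.ncard_iUnion_of_finite (fun i => finite_latticePoints (hQ i) k)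
    fun i j hij => ?_, finsum_eq_sum_of_fintype]
  · rfl
  · exact (Set.disjoint_image_of_injective (smul_right_injective _ hk₀) (hdisj hij)).preimage _

end LatticePoints

section LatticeCoefficients

variable {n d ℓ k : ℕ} {v : Fin n → Fin d → ℝ} {X : Set (Fin d → ℝ)} {c c' : Fin n → ℝ}

/-- Whether a convex combination of the points `v i` belongs to `X` depends only on the support of
its coefficients. This holds for the half-open polyhedra obtained from the polytope with vertices
`v i` by making some of its defining inequalities strict. -/
def IsSupportDetermined (v : Fin n → Fin d → ℝ) (X : Set (Fin d → ℝ)) : Prop :=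
  ∀ c ∈ stdSimplex ℝ (Fin n), ∀ c' ∈ stdSimplex ℝ (Fin n), support c = support c' →
    ∑ i, c i • v i ∈ X → ∑ i, c' i • v i ∈ X

/-- The coefficient vectors, lexicographically minimal and of arbitrary mass `t`, of the points of
`ℤ^d ∩ t X`. -/
def latticeCoeffs (v : Fin n → Fin d → ℝ) (X : Set (Fin d → ℝ)) : Set (Fin n → ℝ) :=
  {c | IsLexMinimal (massAndSum v) c ∧
    ∑ i, c i • v i ∈ ((∑ i, c i) • X) ∩ (integerLattice d : Set (Fin d → ℝ))}

lemma IsSupportDetermined.sum_smul_mem_smul (hX : IsSupportDetermined v X) (hc : 0 ≤ c)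
    (hc' : 0 ≤ c') (hcc' : support c = support c') (h : ∑ i, c i • v i ∈ (∑ i, c i) • X) :
    ∑ i, c' i • v i ∈ (∑ i, c' i) • X := by
  rcases eq_or_ne c 0 with rfl | hne
  · obtain rfl : c' = 0 := support_eq_empty_iff.mp (by simpa using hcc'.symm)
    exact h
  have hne' : c' ≠ 0 := by rwa [← support_nonempty_iff, ← hcc', support_nonempty_iff]
  have hsum {a : Fin n → ℝ} (ha : 0 ≤ a) (hne : a ≠ 0) : 0 < ∑ i, a i := by
    obtain ⟨i, hi⟩ := ne_iff.mp hne
    exact Finset.sum_pos' (fun i _ => ha i) ⟨i, Finset.mem_univ i, (ha i).lt_of_ne' hi⟩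
  have hnormalized {a : Fin n → ℝ} (ha : 0 ≤ a) (hne : a ≠ 0) :
      (∑ i, a i)⁻¹ • a ∈ stdSimplex ℝ (Fin n) :=
    ⟨fun i => mul_nonneg (inv_nonneg.mpr (hsum ha hne).le) (ha i), by
      simp [← Finset.mul_sum, inv_mul_cancel₀ (hsum ha hne).ne']⟩
  rw [Set.mem_smul_set_iff_inv_smul_mem₀ (hsum hc hne).ne'] at h
  rw [Set.mem_smul_set_iff_inv_smul_mem₀ (hsum hc' hne').ne']
  have := hX _ (hnormalized hc hne) _ (hnormalized hc' hne') (by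
    rw [support_const_smul_of_ne_zero _ _ (inv_ne_zero (hsum hc hne).ne'),
      support_const_smul_of_ne_zero _ _ (inv_ne_zero (hsum hc' hne').ne'), hcc'])
  simp only [Pi.smul_apply, smul_assoc, ← Finset.smul_sum] at this
  exact this h

lemma support_add_mul {m : Fin n → ℕ} (hc : 0 ≤ c) (hm : ∀ i, m i ≠ 0 → c i ≠ 0) :
    support (fun i => c i + ℓ * m i) = support c := by
  ext i
  have : 0 ≤ (ℓ * m i : ℝ) := by positivity
  rw [mem_support, mem_support, Ne, add_eq_zero_iff_of_nonneg (hc i) this]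
  refine not_congr (and_iff_left_of_imp fun hi => ?_)
  simp [of_not_not fun h => hm i h hi]

lemma sum_add_mul_smul (v : Fin n → Fin d → ℝ) (c : Fin n → ℝ) (m : Fin n → ℕ) :
    ∑ i, (c i + ℓ * m i) • v i = ∑ i, c i • v i + ∑ i, m i • ((ℓ : ℝ) • v i) := by
  rw [← Finset.sum_add_distrib]
  refine Finset.sum_congr rfl fun i _ => ?_
  module

lemma isSupportPeriodic_latticeCoeffs (hv : ∀ i, (ℓ : ℝ) • v i ∈ integerLattice d)
    (hX : IsSupportDetermined v X) : IsSupportPeriodic ℓ (latticeCoeffs v X) := by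
  refine ⟨fun c hc => hc.1.1, fun c m hc hm => ?_⟩
  have hsupp := support_add_mul (ℓ := ℓ) hc hm
  have hc' : 0 ≤ fun i => c i + ℓ * m i := fun i => add_nonneg (hc i) (by positivity)
  have hlattice : ∑ i, m i • ((ℓ : ℝ) • v i) ∈ integerLattice d :=
    sum_mem fun i _ => nsmul_mem (hv i) (m i)
  refine and_congr (isLexMinimal_iff_of_support_eq hc' hc hsupp) (and_congr
    ⟨hX.sum_smul_mem_smul hc' hc hsupp, hX.sum_smul_mem_smul hc hc' hsupp.symm⟩ ?_)
  rw [sum_add_mul_smul]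
  exact add_mem_cancel_right hlattice

lemma injOn_massSlice_latticeCoeffs :
    Set.InjOn (fun c => ∑ i, c i • v i) (massSlice (latticeCoeffs v X) k) :=
  fun c hc c' hc' h => hc.1.1.eq_of_map_eq hc'.1.1 (by
    rw [massAndSum_apply, massAndSum_apply, hc.2, hc'.2]
    exact congrArg _ h)

lemma image_massSlice_latticeCoeffs (hXv : X ⊆ convexHull ℝ (Set.range v)) (hk : 1 ≤ k) :
    (fun c => ∑ i, c i • v i) '' massSlice (latticeCoeffs v X) k =
      ((k : ℝ) • X) ∩ integerLattice d := by
  refine subset_antisymm ?_ ?_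
  · rintro _ ⟨c, hc, rfl⟩
    exact hc.2 ▸ hc.1.2
  · rintro _ ⟨⟨x, hx, rfl⟩, hlattice⟩
    obtain ⟨c, hc, rfl, hmin⟩ := exists_isLexMinimal_sum_smul_eq v (hXv hx)
    have hkc : 0 ≤ (k : ℝ) • c := smul_nonneg (by positivity) hc.1
    have hmass : ∑ i, ((k : ℝ) • c) i = k := by simp [← Finset.mul_sum, hc.2]
    have hpoint : ∑ i, ((k : ℝ) • c) i • v i = (k : ℝ) • ∑ i, c i • v i := by
      simp only [Pi.smul_apply, smul_assoc, Finset.smul_sum]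
    refine ⟨(k : ℝ) • c, ⟨⟨hmin.of_support_subset hkc ?_, ?_⟩, hmass⟩, hpoint⟩
    · exact support_const_smul_subset (k : ℝ) c
    · rw [hmass, hpoint]
      exact ⟨Set.smul_mem_smul_set hx, hlattice⟩

theorem IsSupportDetermined.hasQuasiPeriod_ehr (hX : IsSupportDetermined v X)
    (hXv : X ⊆ convexHull ℝ (Set.range v)) (hℓ : 1 ≤ ℓ)
    (hv : ∀ i, (ℓ : ℝ) • v i ∈ integerLattice d) : HasQuasiPeriod (ehr X) ℓ := by
  have hbdd : Bornology.IsBounded X :=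
    ((Set.finite_range v).isCompact_convexHull ℝ).isBounded.subset hXv
  have hfin (k : ℕ) (hk : 1 ≤ k) : (massSlice (latticeCoeffs v X) k).Finite := by
    refine Set.Finite.of_finite_image ?_ injOn_massSlice_latticeCoeffs
    rw [image_massSlice_latticeCoeffs hXv hk, ← image_latticePoints]
    exact (finite_latticePoints hbdd k).image _
  refine ((isSupportPeriodic_latticeCoeffs hv hX).hasQuasiPeriod_ncard_massSlice hℓ
    hfin).congr fun k hk => ?_
  rw [ehr_eq_ncard_smul_inter_integerLattice, ← image_massSlice_latticeCoeffs hXv hk,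
    injOn_massSlice_latticeCoeffs.ncard_image]

end LatticeCoefficients

section Polyhedra

variable {ι E : Type*} [AddCommGroup E] [Module ℝ E] {A : E →ₗ[ℝ] (ι → ℝ)} {b : ι → ℝ}
  {S : Set ι} {x y : E}

/-- The polyhedron `A x ≥ b` in a real vector space. -/
def polyhedron (A : E →ₗ[ℝ] (ι → ℝ)) (b : ι → ℝ) : Set E := {x | b ≤ A x}

/-- The polyhedron `A x ≥ b` with the inequalities in `S` made strict. -/
def halfOpenPolyhedron (A : E →ₗ[ℝ] (ι → ℝ)) (b : ι → ℝ) (S : Set ι) : Set E :=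
  {x ∈ polyhedron A b | ∀ i ∈ S, b i < A x i}

lemma halfOpenPolyhedron_empty : halfOpenPolyhedron A b ∅ = polyhedron A b := by
  simp [halfOpenPolyhedron]

lemma convex_polyhedron : Convex ℝ (polyhedron A b) :=
  (convex_Ici b).linear_preimage A

lemma eq_of_mem_extremePoints_polyhedron [Finite ι]
    (hx : x ∈ Set.extremePoints ℝ (polyhedron A b)) (hy : ∀ i, A x i = b i → A y i = b i) :
    y = x := by
  obtain ⟨hxP, hext⟩ := mem_extremePoints_iff_left.mp hx
  have hstep (w : E) (hw : ∀ i, A x i = b i → A w i = 0) :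
      ∃ ε > (0 : ℝ), x + ε • w ∈ polyhedron A b := by
    obtain ⟨ε, hε, hnonneg⟩ := exists_pos_add_smul_nonneg (c := A x - b) (w := A w)
      (sub_nonneg.mpr hxP) fun i hi => (hw i (sub_eq_zero.mp hi)).ge
    refine ⟨ε, hε, show b ≤ A (x + ε • w) from sub_nonneg.mp ?_⟩
    rwa [map_add, map_smul, add_sub_right_comm]
  obtain ⟨ε₁, hε₁, hmem₁⟩ := hstep (y - x) fun i hi => by simp [hy i hi, hi]
  obtain ⟨ε₂, hε₂, hmem₂⟩ := hstep (x - y) fun i hi => by simp [hy i hi, hi]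
  have hseg : x ∈ openSegment ℝ (x + ε₁ • (y - x)) (x + ε₂ • (x - y)) := by
    refine ⟨ε₂ / (ε₂ + ε₁), ε₁ / (ε₂ + ε₁), by positivity, by positivity, by field_simp, ?_⟩
    match_scalars <;> field_simp <;> ring
  simpa [hε₁.ne', sub_eq_zero] using hext _ hmem₁ _ hmem₂ hseg

lemma finite_extremePoints_polyhedron [Finite ι] :
    (Set.extremePoints ℝ (polyhedron A b)).Finite := by
  refine Set.Finite.of_finite_image (f := fun x => {i | A x i = b i}) (Set.toFinite _)
    fun x _ y hy hxy => eq_of_mem_extremePoints_polyhedron hy fun i hi => ?_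
  exact (Set.ext_iff.mp hxy i).mpr hi

lemma isBounded_polyhedron_of_halfOpenPolyhedron {E : Type*}
    [SeminormedAddCommGroup E] [NormedSpace ℝ E] {A : E →ₗ[ℝ] (ι → ℝ)}
    (hne : (halfOpenPolyhedron A b S).Nonempty)
    (hbdd : Bornology.IsBounded (halfOpenPolyhedron A b S)) :
    Bornology.IsBounded (polyhedron A b) := by
  obtain ⟨y, hyP, hyS⟩ := hne
  refine ((hbdd.smul₀ (2 : ℝ)).sub (Bornology.isBounded_singleton (x := y))).subset fun x hx => ?_
  refine ⟨x + y, ⟨midpoint ℝ x y, ⟨?_, fun i hi => ?_⟩, ?_⟩, y, rfl, add_sub_cancel_right x y⟩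
  · exact convex_polyhedron.midpoint_mem hx hyP
  · have := hx i
    have := hyS i hi
    simp only [midpoint_eq_smul_add, map_smul, map_add, Pi.smul_apply, Pi.add_apply, smul_eq_mul,
      invOf_eq_inv]
    linarith
  · simp [midpoint_eq_smul_add]

lemma lt_sum_mul_iff_of_mem_stdSimplex {κ : Type*} [Fintype κ] {c a : κ → ℝ} {t : ℝ}
    (hc : c ∈ stdSimplex ℝ κ) (ha : ∀ l, t ≤ a l) :
    t < ∑ l, c l * a l ↔ ∃ l ∈ support c, t < a l := by
  have hnonneg (l : κ) : 0 ≤ c l * (a l - t) := mul_nonneg (hc.1 l) (sub_nonneg.mpr (ha l))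
  have hsum : ∑ l, c l * a l - t = ∑ l, c l * (a l - t) := by
    simp [mul_sub, ← Finset.sum_mul, hc.2]
  rw [← sub_pos, hsum, Finset.sum_pos_iff_of_nonneg fun l _ => hnonneg l]
  refine exists_congr fun l => ?_
  simp [(hnonneg l).lt_iff_ne', (ha l).lt_iff_ne', sub_eq_zero]

lemma isSupportDetermined_halfOpenPolyhedron {n d : ℕ} {v : Fin n → Fin d → ℝ}
    {A : (Fin d → ℝ) →ₗ[ℝ] (ι → ℝ)} (hv : ∀ l, v l ∈ polyhedron A b) (S : Set ι) :
    IsSupportDetermined v (halfOpenPolyhedron A b S) := by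
  have hlt {c : Fin n → ℝ} (hc : c ∈ stdSimplex ℝ (Fin n)) (i : ι) :
      b i < A (∑ l, c l • v l) i ↔ ∃ l ∈ support c, b i < A (v l) i := by
    rw [← lt_sum_mul_iff_of_mem_stdSimplex hc fun l => hv l i]
    simp
  intro c hc c' hc' hcc' hmem
  refine ⟨convex_polyhedron.sum_mem (fun l _ => hc'.1 l) hc'.2 fun l _ => hv l, fun i hi => ?_⟩
  rw [hlt hc', ← hcc', ← hlt hc]
  exact hmem.2 i hi

end Polyhedra

section RationalPolyhedra

variable {ι : Type*} {d : ℕ} {M : Matrix ι (Fin d) ℚ} {b : ι → ℚ}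

/-- The linear map `ℝ^d → ℝ^ι` given by a rational matrix. -/
def realMulVec (M : Matrix ι (Fin d) ℚ) : (Fin d → ℝ) →ₗ[ℝ] (ι → ℝ) :=
  (M.map (Rat.cast : ℚ → ℝ)).mulVecLin

lemma realMulVec_apply (M : Matrix ι (Fin d) ℚ) (x : Fin d → ℝ) (i : ι) :
    realMulVec M x i = ∑ j, (M i j : ℝ) * x j := rfl

/-- A `ℚ`-linear retraction `ℝ → ℚ` turns a real solution of a rational linear system into a
rational one. -/
lemma exists_rat_realMulVec_eq (x : Fin d → ℝ) : ∃ y : Fin d → ℚ,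
    ∀ i, realMulVec M x i = b i → realMulVec M (fun j => (y j : ℝ)) i = b i := by
  obtain ⟨f, hf⟩ := (Algebra.linearMap ℚ ℝ).exists_leftInverse_of_injective
    (LinearMap.ker_eq_bot.mpr (algebraMap ℚ ℝ).injective)
  have hf' (q : ℚ) : f (q : ℝ) = q := LinearMap.congr_fun hf q
  refine ⟨fun j => f (x j), fun i hi => ?_⟩
  have h : f (∑ j, M i j • x j) = b i := by
    simp only [Rat.smul_def, ← realMulVec_apply, hi, hf']
  simp only [map_sum, map_smul, smul_eq_mul] at h
  rw [realMulVec_apply]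
  exact_mod_cast h

lemma exists_rat_vertices [Finite ι]
    (hbdd : Bornology.IsBounded (polyhedron (realMulVec M) fun i => (b i : ℝ))) :
    ∃ V : Finset (Fin d → ℚ),
      (fun (v : Fin d → ℚ) (j : Fin d) => (v j : ℝ)) '' V =
        Set.extremePoints ℝ (polyhedron (realMulVec M) fun i => (b i : ℝ)) ∧
      convexHull ℝ ((fun (v : Fin d → ℚ) (j : Fin d) => (v j : ℝ)) '' V) =
        polyhedron (realMulVec M) fun i => (b i : ℝ) := by
  set P := polyhedron (realMulVec M) fun i => (b i : ℝ)
  have hcast : Injective fun (v : Fin d → ℚ) (j : Fin d) => (v j : ℝ) :=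
    Rat.cast_injective.comp_left
  have hfin : (Set.extremePoints ℝ P).Finite := finite_extremePoints_polyhedron
  have hrat : Set.extremePoints ℝ P ⊆
      Set.range fun (v : Fin d → ℚ) (j : Fin d) => (v j : ℝ) := fun x hx => by
    obtain ⟨y, hy⟩ := exists_rat_realMulVec_eq (M := M) (b := b) x
    exact ⟨y, eq_of_mem_extremePoints_polyhedron hx hy⟩
  have hclosed : IsClosed P := isClosed_Ici.preimage (realMulVec M).continuous_of_finiteDimensional
  have hV : (fun (v : Fin d → ℚ) (j : Fin d) => (v j : ℝ)) ''
      (hfin.preimage hcast.injOn).toFinset = Set.extremePoints ℝ P := by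
    rw [Set.Finite.coe_toFinset, Set.image_preimage_eq_of_subset hrat]
  refine ⟨_, hV, ?_⟩
  rw [hV, ← (hfin.isCompact_convexHull ℝ).isClosed.closure_eq]
  exact closure_convexHull_extremePoints (Metric.isCompact_of_isClosed_isBounded hclosed hbdd)
    convex_polyhedron

end RationalPolyhedra

section Ehrhart

variable {d : ℕ}

lemma one_le_lcmDenominators (V : Finset (Fin d → ℚ)) : 1 ≤ lcmDenominators V := by
  simp [Nat.one_le_iff_ne_zero, lcmDenominators, Finset.lcm_eq_zero_iff]

lemma lcmDenominators_smul_mem_integerLattice {V : Finset (Fin d → ℚ)} {v : Fin d → ℚ}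
    (hv : v ∈ V) : ((lcmDenominators V : ℝ) • fun j => (v j : ℝ)) ∈ integerLattice d := by
  have hdvd (j : Fin d) : (v j).den ∣ lcmDenominators V :=
    (Finset.dvd_lcm (f := fun j => (v j).den) (Finset.mem_univ j)).trans
      (Finset.dvd_lcm (f := fun v : Fin d → ℚ => Finset.univ.lcm fun j => (v j).den) hv)
  choose t ht using hdvd
  refine ⟨fun j => t j * (v j).num, funext fun j => ?_⟩
  have hcast : ((v j).den : ℝ) * v j = (v j).num := by exact_mod_cast Rat.den_mul_eq_num (v j)
  simp only [AddMonoidHom.compLeft_apply, comp_apply, Int.coe_castAddHom, Pi.smul_apply,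
    smul_eq_mul, ht j]
  push_cast
  rw [← hcast]
  ring

lemma hasQuasiPeriod_ehr_halfOpenPolyhedron {ι : Type*} {A : (Fin d → ℝ) →ₗ[ℝ] (ι → ℝ)}
    {b : ι → ℝ} {V : Finset (Fin d → ℚ)}
    (hV : convexHull ℝ ((fun (v : Fin d → ℚ) (j : Fin d) => (v j : ℝ)) '' V) = polyhedron A b)
    (S : Set ι) : HasQuasiPeriod (ehr (halfOpenPolyhedron A b S)) (lcmDenominators V) := by
  let v (l : Fin V.card) (j : Fin d) : ℝ := (V.equivFin.symm l : Fin d → ℚ) j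
  have hrange : Set.range v = (fun (v : Fin d → ℚ) (j : Fin d) => (v j : ℝ)) '' V :=
    (V.equivFin.symm.surjective.range_comp fun (w : V) j => ((w : Fin d → ℚ) j : ℝ)).trans
      (Set.image_eq_range (fun (v : Fin d → ℚ) (j : Fin d) => (v j : ℝ)) V).symm
  rw [← hrange] at hV
  have hvP (l : Fin V.card) : v l ∈ polyhedron A b :=
    hV ▸ subset_convexHull ℝ _ (Set.mem_range_self l)
  exact (isSupportDetermined_halfOpenPolyhedron hvP S).hasQuasiPeriod_ehr (hV ▸ Set.sep_subset _ _)
    (one_le_lcmDenominators V) fun l =>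
      lcmDenominators_smul_mem_integerLattice (V.equivFin.symm l).2

lemma IsPolyhedron.exists_eq_polyhedron {P : Set (Fin d → ℝ)} (hP : IsPolyhedron P) :
    ∃ (m : ℕ) (M : Matrix (Fin m) (Fin d) ℚ) (b : Fin m → ℚ),
      P = polyhedron (realMulVec M) fun i => (b i : ℝ) := by
  obtain ⟨m, M, b, rfl⟩ := hP
  refine ⟨m, M.map (↑), fun i => b i, ?_⟩
  simp [polyhedron, Pi.le_def, realMulVec_apply]

lemma IsHalfOpenPolyhedron.exists_eq_halfOpenPolyhedron {Q : Set (Fin d → ℝ)}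
    (hQ : IsHalfOpenPolyhedron Q) :
    ∃ (m : ℕ) (M : Matrix (Fin m) (Fin d) ℚ) (b : Fin m → ℚ) (S : Set (Fin m)),
      Q = halfOpenPolyhedron (realMulVec M) (fun i => (b i : ℝ)) S := by
  obtain ⟨m, M, b, S, rfl⟩ := hQ
  refine ⟨m, M.map (↑), fun i => b i, S, Set.ext fun x => ?_⟩
  simp only [halfOpenPolyhedron, polyhedron, Pi.le_def, realMulVec_apply, Matrix.map_apply,
    Rat.cast_intCast, Set.mem_ofPred_eq]
  refine and_congr_left fun hS => ⟨fun h i => ?_, fun h i _ => h i⟩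
  by_cases hi : i ∈ S
  exacts [(hS i hi).le, h i hi]

lemma IsHalfOpenPolytope.exists_hasQuasiPeriod {Q : Set (Fin d → ℝ)}
    (hQ : IsHalfOpenPolytope Q) : ∃ ℓ, 1 ≤ ℓ ∧ HasQuasiPeriod (ehr Q) ℓ := by
  rcases Q.eq_empty_or_nonempty with rfl | hne
  · exact ⟨1, le_rfl, (HasQuasiPeriod.zero le_rfl).congr fun k _ => by simp [ehr, latticePoints]⟩
  · obtain ⟨m, M, b, S, rfl⟩ := hQ.1.exists_eq_halfOpenPolyhedron
    obtain ⟨V, -, hV⟩ := exists_rat_vertices (isBounded_polyhedron_of_halfOpenPolyhedron hne hQ.2)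
    exact ⟨_, one_le_lcmDenominators V, hasQuasiPeriod_ehr_halfOpenPolyhedron hV S⟩

lemma IsPolytope.exists_vertices_hasQuasiPeriod {P : Set (Fin d → ℝ)} (hP : IsPolytope P) :
    ∃ V : Finset (Fin d → ℚ),
      (fun (v : Fin d → ℚ) (j : Fin d) => (v j : ℝ)) '' V = Set.extremePoints ℝ P ∧
        HasQuasiPeriod (ehr P) (lcmDenominators V) := by
  obtain ⟨m, M, b, rfl⟩ := hP.1.exists_eq_polyhedron
  obtain ⟨V, hext, hV⟩ := exists_rat_vertices hP.2
  refine ⟨V, hext, ?_⟩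
  rw [← halfOpenPolyhedron_empty]
  exact hasQuasiPeriod_ehr_halfOpenPolyhedron hV ∅

lemma IsPartialPolytopalComplex.exists_hasQuasiPeriod {X : Set (Fin d → ℝ)}
    (hX : IsPartialPolytopalComplex X) : ∃ ℓ, HasQuasiPeriod (ehr X) ℓ := by
  obtain ⟨n, Q, hQ, hdisj, rfl⟩ := hX
  choose ℓ hℓ hper using fun i => (hQ i).exists_hasQuasiPeriod
  have hL : 1 ≤ ∏ i, ℓ i := Finset.one_le_prod' fun i _ => hℓ i
  exact ⟨∏ i, ℓ i, (HasQuasiPeriod.sum hL Finset.univ fun i _ =>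
    (hper i).of_dvd hL (Finset.dvd_prod_of_mem ℓ (Finset.mem_univ i))).congr
      fun k hk => ehr_iUnion (fun i => (hQ i).2) hdisj hk⟩

lemma IsPartialPolytopalComplex.isBounded {X : Set (Fin d → ℝ)}
    (hX : IsPartialPolytopalComplex X) : Bornology.IsBounded X := by
  obtain ⟨n, Q, hQ, -, rfl⟩ := hX
  exact Bornology.isBounded_iUnion.mpr fun i => (hQ i).2

end Ehrhart

end EhrhartTheory

theorem mainTheorem1 (d : ℕ) :
    (∀ X : Set (Fin d → ℝ), EhrhartTheory.IsPartialPolytopalComplex X →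
      (∀ k : ℕ, 1 ≤ k → (EhrhartTheory.latticePoints X k).Finite) ∧
      ∃ q : ℤ → ℚ, EhrhartTheory.IsQuasipolynomial q ∧
        EhrhartTheory.AgreesOnPositive (EhrhartTheory.ehr X) q) ∧
    (∀ P : Set (Fin d → ℝ), EhrhartTheory.IsPolytope P →
      -- `V` is the set of vertices of `P`, which are finitely many rational points
      ∃ V : Finset (Fin d → ℚ),
        (fun (v : Fin d → ℚ) (j : Fin d) => (v j : ℝ)) '' (V : Set (Fin d → ℚ)) =
          Set.extremePoints ℝ P ∧
        ∃ q : ℤ → ℚ,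
          EhrhartTheory.IsQuasipolynomialWithPeriod q (EhrhartTheory.lcmDenominators V) ∧
          EhrhartTheory.AgreesOnPositive (EhrhartTheory.ehr P) q) := by
  refine ⟨fun X hX => ⟨fun k _ => EhrhartTheory.finite_latticePoints hX.isBounded k, ?_⟩,
    fun P hP => hP.exists_vertices_hasQuasiPeriod⟩
  obtain ⟨ℓ, q, hq, hXq⟩ := hX.exists_hasQuasiPeriod
  exact ⟨q, ⟨ℓ, hq⟩, hXq⟩
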